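/- Let $b>1$ be a real number and let $(X_n)_{n\ge 1}$ be a (strictly) stationary sequence of positive random variables on a probability space $(\Omega,\mathcal T,P)$, i.e. for every $m\ge 0$ the sequences $(X_{n+m})_{n\ge 1}$ and $(X_n)_{n\ge 1}$ have the same joint law. For $n\ge 1$ put $Y_n=\prod_{k=1}^{n}X_k$, and for an integer $h$ and a real $x$ put $e_h(x)=\exp(2i\pi hx)$. The mantissa in base $b$ of a real number $x>0$ is the unique $\mathcal M_b(x)\in[1,b)$ such that $x=\mathcal M_b(x)\,b^k$ for some integer $k$. A sequence $(u_n)_{n\ge1}$ of positive real numbers is called Benford in base $b$ if $$\lim_{N\to+\infty}\frac1N\sum_{n=1}^{N}\mathbf 1_{[1,a)}(\mathcal M_b(u_n))=\log_b a\qquad\text{for all } 1\le a<b .$$ The sequence $(Y_n)$ is called almost surely Benford in base $b$ if $P(\{\omega : (Y_n(\omega))_{n\ge1}\text{ is Benford in base } b\})=1$. Then $(Y_n)$ is almost surely Benford in base $b$ if and only if $$\lim_{L\to+\infty}\frac1L\sum_{l=1}^{L}\mathbb E\bigl(e_h(\log_b Y_l)\bigr)=0\qquad\text{for every integer } h\ge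 1 .$$ -/

import Mathlib

open MeasureTheory Filter Topology

namespace Benford

/-- The mantissa in base `b` of a positive real number `x`: the number `m` in `[1, b)` such that
`x = m * b ^ k` for some integer `k` (see `mantissa_mem`, `mantissa_mul`, `mantissa_unique`). -/
noncomputable def mantissa (b x : ℝ) : ℝ :=
  x / b ^ ⌊Real.logb b x⌋

theorem mantissa_mul {b x : ℝ} (hb : 1 < b) :
    ∃ k : ℤ, x = mantissa b x * b ^ k := by
  refine ⟨⌊Real.logb b x⌋, ?_⟩
  have h : b ^ ⌊Real.logb b x⌋ ≠ 0 := zpow_ne_zero _ (by linarith)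
  rw [mantissa, div_mul_cancel₀ _ h]

theorem mantissa_unique {b x m : ℝ} (hb : 1 < b) (hm : m ∈ Set.Ico 1 b) (k : ℤ)
    (h : x = m * b ^ k) : m = mantissa b x := by
  have hb0 : 0 < b := by linarith
  have hm0 : 0 < m := by linarith [hm.1]
  have hk : ⌊Real.logb b x⌋ = k := by
    rw [h, Real.logb_mul hm0.ne' (zpow_ne_zero _ hb0.ne'), ← Real.rpow_intCast,
      Real.logb_rpow hb0 hb.ne', Int.floor_add_intCast]
    have h1 : 0 ≤ Real.logb b m := Real.logb_nonneg hb hm.1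
    have h2 : Real.logb b m < 1 := by
      rw [Real.logb_lt_iff_lt_rpow hb hm0, Real.rpow_one]; exact hm.2
    have : ⌊Real.logb b m⌋ = 0 := Int.floor_eq_zero_iff.2 ⟨h1, h2⟩
    omega
  rw [mantissa, hk, h, mul_div_cancel_right₀ _ (zpow_ne_zero _ hb0.ne')]

theorem mantissa_mem {b x : ℝ} (hb : 1 < b) (hx : 0 < x) : mantissa b x ∈ Set.Ico 1 b := by
  have hb0 : 0 < b := by linarith
  have hp : 0 < b ^ ⌊Real.logb b x⌋ := zpow_pos hb0 _
  constructor
  · rw [mantissa, le_div_iff₀ hp, one_mul, ← Real.rpow_intCast, ← Real.le_logb_iff_rpow_le hb hx]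
    exact Int.floor_le _
  · rw [mantissa, div_lt_iff₀ hp, ← zpow_one_add₀ hb0.ne', ← Real.rpow_intCast,
      ← Real.logb_lt_iff_lt_rpow hb hx]
    push_cast
    linarith [Int.lt_floor_add_one (Real.logb b x)]

/-- A sequence `v 1, v 2, …` of numbers in `[1, b)` is distributed following Benford's law in
base `b`: for `1 ≤ a < b`, the set of `n ≥ 1` with `v n ∈ [1, a)` has natural density
`log_b a`. -/
def DistributedAsBenford (b : ℝ) (v : ℕ → ℝ) : Prop :=
  ∀ a : ℝ, 1 ≤ a → a < b →
    Tendsto (fun N : ℕ =>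
        (1 / (N : ℝ)) * ∑ n ∈ Finset.Icc 1 N, Set.indicator (Set.Ico 1 a) (fun _ => (1 : ℝ)) (v n))
      atTop (𝓝 (Real.logb b a))

/-- A sequence `u 1, u 2, …` of positive numbers is Benford in base `b`: its sequence of mantissae
is distributed following Benford's law. -/
def IsBenford (b : ℝ) (u : ℕ → ℝ) : Prop :=
  DistributedAsBenford b (fun n => mantissa b (u n))

/-- The function `e_h(x) = exp(2 i π h x)`. -/
noncomputable def e (h : ℤ) (x : ℝ) : ℂ :=
  Complex.exp (2 * Complex.I * Real.pi * h * x)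

/-- The product `Y_n = X_1 ⋯ X_n`. -/
noncomputable def prodSeq {Ω : Type*} (X : ℕ → Ω → ℝ) (n : ℕ) (ω : Ω) : ℝ :=
  ∏ k ∈ Finset.Icc 1 n, X k ω

/-- `Z 1, Z 2, …` is almost surely Benford in base `b`. -/
def AlmostSurelyBenford {Ω : Type*} [MeasurableSpace Ω] (P : Measure Ω) (b : ℝ)
    (Z : ℕ → Ω → ℝ) : Prop :=
  ∀ᵐ ω ∂P, IsBenford b (fun n => Z n ω)

/-- The sequence of random variables `X 1, X 2, …` is (strictly) stationary: for every `m`, the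
sequences `(X_{1+m}, X_{2+m}, …)` and `(X_1, X_2, …)` have the same joint law. The term `X 0` plays
no role. -/
def IsStationary {Ω : Type*} [MeasurableSpace Ω] (P : Measure Ω) (X : ℕ → Ω → ℝ) : Prop :=
  ∀ m : ℕ, P.map (fun ω (n : ℕ) => X (n + 1 + m) ω) = P.map (fun ω (n : ℕ) => X (n + 1) ω)

end Benford

/-! By Weyl's criterion, applied to `Real.logb b (Y_n)`, being Benford means that for every h ≥ 1
the averages of e_h(log_b Y_l) tend to 0. If this holds almost surely, dominated convergence gives
the limit of the expectations, since the averages have modulus at most 1.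

For the converse, pass to sequence space, where stationarity says that the shift T preserves the law
μ. There e_h(log_b Y_l) is a multiplicative cocycle with values in the unit circle; let S_n be the
sum of its first n terms. From S_{n+1}(x) = φ(x)(1 + S_n(Tx)) and |φ| = 1 one gets E|S_{n+1}|² -
E|S_n|² = 1 + 2 Re E S_n. If E S_n = o(n), then E|S_n|² = o(n²), so E|S_n| = o(n).

Convergence in mean becomes almost sure convergence through the maximal inequality: averaging over
windows of length K gives K|S_L| ≤ ∑_{l<L} |S_K ∘ T^l| + 2K², and the maximal inequality for |S_K|
bounds the probability that |S_L| > 2cL infinitely often by E|S_K|/(cK), for every K. Neither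
ergodicity nor the pointwise ergodic theorem is needed (`ae_tendsto_cocycleSum_div`). -/

namespace Benford

/-! ### Maximal ergodic theorem and maximal inequality -/

section MaximalErgodic

variable {α : Type*}

/-- The running maximum `max (0, S₁ f, …, Sₙ f)` of the Birkhoff sums of `f`. -/
noncomputable def birkhoffMax (T : α → α) (f : α → ℝ) : ℕ → α → ℝ
  | 0 => fun _ => 0
  | n + 1 => fun x => max 0 (f x + birkhoffMax T f n (T x))

theorem birkhoffMax_nonneg (T : α → α) (f : α → ℝ) (n : ℕ) (x : α) :
    0 ≤ birkhoffMax T f n x := by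
  cases n with
  | zero => exact le_rfl
  | succ n => exact le_max_left _ _

theorem birkhoffMax_le_succ (T : α → α) (f : α → ℝ) (n : ℕ) (x : α) :
    birkhoffMax T f n x ≤ birkhoffMax T f (n + 1) x := by
  induction n generalizing x with
  | zero => exact birkhoffMax_nonneg T f 1 x
  | succ n ih => exact max_le_max le_rfl (add_le_add le_rfl (ih (T x)))

theorem birkhoffSum_le_birkhoffMax (T : α → α) (f : α → ℝ) (n : ℕ) (x : α) :
    birkhoffSum T f n x ≤ birkhoffMax T f n x := by
  induction n generalizing x with
  | zero => simp [birkhoffMax]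
  | succ n ih =>
    rw [birkhoffSum_succ']
    exact (add_le_add le_rfl (ih (T x))).trans (le_max_right _ _)

variable [MeasurableSpace α] {μ : Measure α} {T : α → α} {f : α → ℝ}

theorem measurable_birkhoffMax (hT : Measurable T) (hf : Measurable f) (n : ℕ) :
    Measurable (birkhoffMax T f n) := by
  induction n with
  | zero => exact measurable_const
  | succ n ih => exact measurable_const.max (hf.add (ih.comp hT))

theorem integrable_birkhoffMax (hT : MeasurePreserving T μ μ) (hf : Integrable f μ) (n : ℕ) :
    Integrable (birkhoffMax T f n) μ := by
  induction n with
  | zero => exact integrable_zero _ _ _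
  | succ n ih => exact (integrable_zero _ _ _).sup (hf.add (hT.integrable_comp_of_integrable ih))

/-- The maximal ergodic theorem. -/
theorem setIntegral_birkhoffMax_pos_nonneg (hT : MeasurePreserving T μ μ) (hfm : Measurable f)
    (hf : Integrable f μ) (n : ℕ) : 0 ≤ ∫ x in {x | 0 < birkhoffMax T f n x}, f x ∂μ := by
  set M := birkhoffMax T f n with hM
  have hMm : Measurable M := measurable_birkhoffMax hT.measurable hfm n
  have hMi : Integrable M μ := integrable_birkhoffMax hT hf n
  have hMTi : Integrable (fun x => M (T x)) μ := hT.integrable_comp_of_integrable hMi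
  have hE : MeasurableSet {x | 0 < M x} := measurableSet_lt measurable_const hMm
  -- Where the maximum is positive it is not attained by 0, so M_{n+1} = f + M_n ∘ T ≤ f + M_{n+1} ∘
  -- T there.
  have hpt : ∀ x ∈ {x | 0 < M x}, M x - M (T x) ≤ f x := by
    intro x hx
    rcases n with _ | n
    · exact absurd (show (0 : ℝ) < 0 from hx) (lt_irrefl _)
    · have h1 : M x = max 0 (f x + birkhoffMax T f n (T x)) := rfl
      have h2 : 0 < M x := hx
      have h3 := birkhoffMax_le_succ T f n (T x)
      rw [h1, lt_max_iff] at h2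
      have h4 := h2.resolve_left (lt_irrefl _)
      rw [h1, max_eq_right h4.le]
      linarith
  have h1 : ∫ x in {x | 0 < M x}, (M x - M (T x)) ∂μ ≤ ∫ x in {x | 0 < M x}, f x ∂μ :=
    setIntegral_mono_on (hMi.sub hMTi).integrableOn hf.integrableOn hE hpt
  have h2 : ∫ x in {x | 0 < M x}, M x ∂μ = ∫ x, M x ∂μ := by
    refine setIntegral_eq_integral_of_forall_compl_eq_zero fun x hx => ?_
    exact le_antisymm (not_lt.1 hx) (birkhoffMax_nonneg T f n x)
  have h3 : ∫ x in {x | 0 < M x}, M (T x) ∂μ ≤ ∫ x, M (T x) ∂μ :=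
    setIntegral_le_integral hMTi (Eventually.of_forall fun x => birkhoffMax_nonneg T f n (T x))
  have h4 : ∫ x, M (T x) ∂μ = ∫ x, M x ∂μ := by
    conv_rhs => rw [← hT.map_eq]
    exact (integral_map hT.aemeasurable hMm.aestronglyMeasurable).symm
  rw [integral_sub hMi.integrableOn hMTi.integrableOn] at h1
  linarith

/-- The maximal inequality for the Birkhoff averages of a nonnegative function. -/
theorem measure_exists_lt_birkhoffSum_le [IsFiniteMeasure μ] (hT : MeasurePreserving T μ μ)
    (hfm : Measurable f) (hf : Integrable f μ) (hf0 : ∀ x, 0 ≤ f x) {c : ℝ} (hc : 0 < c) :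
    μ {x | ∃ n : ℕ, n * c < birkhoffSum T f n x} ≤ ENNReal.ofReal ((∫ x, f x ∂μ) / c) := by
  -- The maximal theorem for f - c on E = {max > 0} gives c μ(E) ≤ ∫_E f ≤ ∫ f.
  set g : α → ℝ := fun x => f x - c
  have hgm : Measurable g := hfm.sub measurable_const
  have hg : Integrable g μ := hf.sub (integrable_const c)
  have hsum : ∀ n x, birkhoffSum T g n x = birkhoffSum T f n x - n * c := by
    intro n x
    simp [birkhoffSum, g, Finset.sum_sub_distrib]
  have hsub : {x | ∃ n : ℕ, n * c < birkhoffSum T f n x} ⊆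
      ⋃ n, {x | 0 < birkhoffMax T g n x} := by
    rintro x ⟨n, hn⟩
    refine Set.mem_iUnion.2 ⟨n, lt_of_lt_of_le ?_ (birkhoffSum_le_birkhoffMax T g n x)⟩
    rw [hsum]
    linarith
  have hmono : Monotone fun n => {x | 0 < birkhoffMax T g n x} :=
    monotone_nat_of_le_succ fun n x hx => lt_of_lt_of_le hx (birkhoffMax_le_succ T g n x)
  refine (measure_mono hsub).trans ?_
  rw [hmono.measure_iUnion]
  refine iSup_le fun n => ?_
  have hE : MeasurableSet {x | 0 < birkhoffMax T g n x} :=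
    measurableSet_lt measurable_const (measurable_birkhoffMax hT.measurable hgm n)
  have h1 := setIntegral_birkhoffMax_pos_nonneg hT hgm hg n
  rw [integral_sub hf.integrableOn (integrable_const c).integrableOn, setIntegral_const,
    smul_eq_mul] at h1
  have h2 := setIntegral_le_integral (s := {x | 0 < birkhoffMax T g n x}) hf
    (Eventually.of_forall hf0)
  rw [← ofReal_measureReal]
  refine ENNReal.ofReal_le_ofReal ?_
  rw [le_div_iff₀ hc]
  linarith

end MaximalErgodic

/-! ### Sums of unimodular cocycles: from means to almost sure convergence -/

section Cocycle

variable {α : Type*}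

/-- The multiplicative cocycle `φ x * φ (T x) * ⋯ * φ (T^[n-1] x)`. -/
def birkhoffProd (T : α → α) (φ : α → ℂ) (n : ℕ) (x : α) : ℂ :=
  ∏ k ∈ Finset.range n, φ (T^[k] x)

/-- The sum of the values at `1, …, n` of the multiplicative cocycle generated by `φ`. -/
def cocycleSum (T : α → α) (φ : α → ℂ) (n : ℕ) (x : α) : ℂ :=
  ∑ l ∈ Finset.range n, birkhoffProd T φ (l + 1) x

theorem birkhoffProd_add (T : α → α) (φ : α → ℂ) (m n : ℕ) (x : α) :
    birkhoffProd T φ (m + n) x = birkhoffProd T φ m x * birkhoffProd T φ n (T^[m] x) := by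
  rw [birkhoffProd, Finset.prod_range_add]
  congr 1
  refine Finset.prod_congr rfl fun k _ => ?_
  rw [← Function.iterate_add_apply, add_comm]

theorem norm_birkhoffProd {T : α → α} {φ : α → ℂ} (hφ : ∀ x, ‖φ x‖ = 1) (n : ℕ) (x : α) :
    ‖birkhoffProd T φ n x‖ = 1 := by
  simp [birkhoffProd, norm_prod, hφ]

theorem norm_cocycleSum_le {T : α → α} {φ : α → ℂ} (hφ : ∀ x, ‖φ x‖ = 1) (n : ℕ) (x : α) :
    ‖cocycleSum T φ n x‖ ≤ n := by
  refine (norm_sum_le _ _).trans ?_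
  simp [norm_birkhoffProd hφ]

theorem cocycleSum_succ (T : α → α) (φ : α → ℂ) (n : ℕ) (x : α) :
    cocycleSum T φ (n + 1) x = φ x * (1 + cocycleSum T φ n (T x)) := by
  have h : ∀ l, birkhoffProd T φ (l + 1) x = φ x * birkhoffProd T φ l (T x) := by
    intro l
    rw [add_comm, birkhoffProd_add]
    simp [birkhoffProd]
  simp only [cocycleSum, h, ← Finset.mul_sum]
  rw [Finset.sum_range_succ']
  simp [birkhoffProd, add_comm]

/-- The factor φ x drops out of the modulus, leaving |1 + S_n(Tx)|². Once integrated, this lets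
first moments control second moments. -/
theorem norm_cocycleSum_succ_sq {T : α → α} {φ : α → ℂ} (hφ : ∀ x, ‖φ x‖ = 1) (n : ℕ) (x : α) :
    ‖cocycleSum T φ (n + 1) x‖ ^ 2 =
      1 + 2 * (cocycleSum T φ n (T x)).re + ‖cocycleSum T φ n (T x)‖ ^ 2 := by
  rw [cocycleSum_succ, norm_mul, hφ, one_mul, Complex.sq_norm, Complex.sq_norm,
    Complex.normSq_apply, Complex.normSq_apply]
  simp only [Complex.add_re, Complex.add_im, Complex.one_re, Complex.one_im]
  ring

/-- Averaging the values of the cocycle over windows of length `K` changes its sums by a bounded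
amount. -/
theorem mul_norm_cocycleSum_le {T : α → α} {φ : α → ℂ} (hφ : ∀ x, ‖φ x‖ = 1) (K L : ℕ) (x : α) :
    K * ‖cocycleSum T φ L x‖ ≤
      birkhoffSum T (fun y => ‖cocycleSum T φ K y‖) L x + 2 * (K : ℝ) ^ 2 := by
  have h1 : ∑ l ∈ Finset.range L, birkhoffProd T φ l x * cocycleSum T φ K (T^[l] x) =
      ∑ k ∈ Finset.range K, ∑ l ∈ Finset.range L, birkhoffProd T φ (l + (k + 1)) x := by
    rw [Finset.sum_comm]
    refine Finset.sum_congr rfl fun l _ => ?_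
    rw [cocycleSum, Finset.mul_sum]
    exact Finset.sum_congr rfl fun k _ => (birkhoffProd_add T φ l (k + 1) x).symm
  -- The terms 1, …, L and k+1, …, k+L differ by at most k terms at each end, all of modulus 1.
  have h2 : ∀ k ∈ Finset.range K,
      ‖cocycleSum T φ L x - ∑ l ∈ Finset.range L, birkhoffProd T φ (l + (k + 1)) x‖
        ≤ 2 * (K : ℝ) := by
    intro k hk
    have hkK : (k : ℝ) ≤ K := by exact_mod_cast (Finset.mem_range.1 hk).le
    have e1 : cocycleSum T φ (L + k) x = cocycleSum T φ L x +
        ∑ j ∈ Finset.range k, birkhoffProd T φ (L + j + 1) x := by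
      simp only [cocycleSum, Finset.sum_range_add]
    have e2 : cocycleSum T φ (L + k) x = cocycleSum T φ k x +
        ∑ l ∈ Finset.range L, birkhoffProd T φ (l + (k + 1)) x := by
      rw [add_comm L k]
      simp only [cocycleSum, Finset.sum_range_add]
      congr 1
      exact Finset.sum_congr rfl fun l _ => by congr 1; omega
    have e3 : cocycleSum T φ L x - ∑ l ∈ Finset.range L, birkhoffProd T φ (l + (k + 1)) x =
        cocycleSum T φ k x - ∑ j ∈ Finset.range k, birkhoffProd T φ (L + j + 1) x := by
      linear_combination e2 - e1
    rw [e3]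
    have e4 : ‖∑ j ∈ Finset.range k, birkhoffProd T φ (L + j + 1) x‖ ≤ k := by
      refine (norm_sum_le _ _).trans ?_
      simp [norm_birkhoffProd hφ]
    linarith [norm_sub_le (cocycleSum T φ k x)
      (∑ j ∈ Finset.range k, birkhoffProd T φ (L + j + 1) x), norm_cocycleSum_le (T := T) hφ k x]
  have h3 : ‖(K : ℂ) * cocycleSum T φ L x -
      ∑ l ∈ Finset.range L, birkhoffProd T φ l x * cocycleSum T φ K (T^[l] x)‖
        ≤ 2 * (K : ℝ) ^ 2 := by
    have e : (K : ℂ) * cocycleSum T φ L x = ∑ k ∈ Finset.range K, cocycleSum T φ L x := by simp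
    rw [h1, e, ← Finset.sum_sub_distrib]
    refine (norm_sum_le_of_le _ h2).trans ?_
    simp only [Finset.sum_const, Finset.card_range, nsmul_eq_mul]
    exact le_of_eq (by ring)
  have h4 : ‖∑ l ∈ Finset.range L, birkhoffProd T φ l x * cocycleSum T φ K (T^[l] x)‖ ≤
      birkhoffSum T (fun y => ‖cocycleSum T φ K y‖) L x := by
    refine norm_sum_le_of_le _ fun l _ => ?_
    rw [norm_mul, norm_birkhoffProd hφ, one_mul]
  have h5 : K * ‖cocycleSum T φ L x‖ = ‖(K : ℂ) * cocycleSum T φ L x‖ := by simp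
  rw [h5]
  linarith [norm_sub_norm_le ((K : ℂ) * cocycleSum T φ L x)
    (∑ l ∈ Finset.range L, birkhoffProd T φ l x * cocycleSum T φ K (T^[l] x))]

variable [MeasurableSpace α] {μ : Measure α} {T : α → α} {φ : α → ℂ}

theorem measurable_birkhoffProd (hT : Measurable T) (hφ : Measurable φ) (n : ℕ) :
    Measurable (birkhoffProd T φ n) :=
  Finset.measurable_prod _ fun k _ => hφ.comp (hT.iterate k)

theorem measurable_cocycleSum (hT : Measurable T) (hφ : Measurable φ) (n : ℕ) :
    Measurable (cocycleSum T φ n) :=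
  Finset.measurable_sum _ fun l _ => measurable_birkhoffProd hT hφ (l + 1)

theorem integrable_cocycleSum [IsFiniteMeasure μ] (hT : Measurable T) (hφm : Measurable φ)
    (hφ : ∀ x, ‖φ x‖ = 1) (n : ℕ) : Integrable (cocycleSum T φ n) μ :=
  Integrable.of_bound (measurable_cocycleSum hT hφm n).aestronglyMeasurable n
    (Eventually.of_forall fun x => norm_cocycleSum_le hφ n x)

theorem integrable_norm_cocycleSum_sq [IsFiniteMeasure μ] (hT : Measurable T)
    (hφm : Measurable φ) (hφ : ∀ x, ‖φ x‖ = 1) (n : ℕ) :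
    Integrable (fun x => ‖cocycleSum T φ n x‖ ^ 2) μ := by
  refine Integrable.of_bound
    ((measurable_cocycleSum hT hφm n).norm.pow_const 2).aestronglyMeasurable ((n : ℝ) ^ 2)
    (Eventually.of_forall fun x => ?_)
  rw [norm_pow, norm_norm]
  exact pow_le_pow_left₀ (norm_nonneg _) (norm_cocycleSum_le hφ n x) 2

theorem integral_norm_cocycleSum_succ_sq [IsProbabilityMeasure μ] (hT : MeasurePreserving T μ μ)
    (hφm : Measurable φ) (hφ : ∀ x, ‖φ x‖ = 1) (n : ℕ) :
    ∫ x, ‖cocycleSum T φ (n + 1) x‖ ^ 2 ∂μ =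
      1 + 2 * (∫ x, cocycleSum T φ n x ∂μ).re + ∫ x, ‖cocycleSum T φ n x‖ ^ 2 ∂μ := by
  have hi := integrable_cocycleSum (μ := μ) hT.measurable hφm hφ n
  have hi2 := integrable_norm_cocycleSum_sq (μ := μ) hT.measurable hφm hφ n
  have hre : ∫ x, (cocycleSum T φ n x).re ∂μ = (∫ x, cocycleSum T φ n x ∂μ).re :=
    integral_re hi
  have hm : Measurable fun x =>
      1 + 2 * (cocycleSum T φ n x).re + ‖cocycleSum T φ n x‖ ^ 2 := by
    have := measurable_cocycleSum hT.measurable hφm n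
    fun_prop
  have h1 : ∫ x, ‖cocycleSum T φ (n + 1) x‖ ^ 2 ∂μ =
      ∫ x, (1 + 2 * (cocycleSum T φ n x).re + ‖cocycleSum T φ n x‖ ^ 2) ∂μ := by
    conv_rhs => rw [← hT.map_eq]
    rw [integral_map hT.aemeasurable hm.aestronglyMeasurable]
    exact integral_congr_ae (Eventually.of_forall fun x => norm_cocycleSum_succ_sq hφ n x)
  have hir : Integrable (fun x => 2 * (cocycleSum T φ n x).re) μ := hi.re.const_mul 2
  have hir1 : Integrable (fun x => 1 + 2 * (cocycleSum T φ n x).re) μ := (integrable_const 1).add hir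
  rw [h1, integral_add hir1 hi2, integral_add (integrable_const 1) hir,
    integral_const_mul, hre]
  simp

/-- If the means of the cocycle sums are `o(n)`, then their second moments are `o(n ^ 2)`. -/
theorem tendsto_integral_norm_cocycleSum_sq_div [IsProbabilityMeasure μ]
    (hT : MeasurePreserving T μ μ) (hφm : Measurable φ) (hφ : ∀ x, ‖φ x‖ = 1)
    (h : Tendsto (fun n : ℕ => (1 / (n : ℂ)) * ∫ x, cocycleSum T φ n x ∂μ) atTop (𝓝 0)) :
    Tendsto (fun n : ℕ => (∫ x, ‖cocycleSum T φ n x‖ ^ 2 ∂μ) / (n : ℝ) ^ 2) atTop (𝓝 0) := by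
  -- Chosen so that (n + 1) c_n dominates the increment 1 + 2 Re E S_n, including at n = 0, and c_n
  -- → 0. Then E|S_n|² ≤ n ∑_{j<n} c_j, and Cesàro averaging concludes.
  set c : ℕ → ℝ := fun n => 1 / ((n : ℝ) + 1) + 2 * ‖(1 / (n : ℂ)) * ∫ x, cocycleSum T φ n x ∂μ‖
  have hc : Tendsto c atTop (𝓝 0) := by
    have := (tendsto_one_div_add_atTop_nhds_zero_nat (𝕜 := ℝ)).add (h.norm.const_mul 2)
    rwa [norm_zero, mul_zero, add_zero] at this
  have hstep : ∀ n : ℕ, ∫ x, ‖cocycleSum T φ (n + 1) x‖ ^ 2 ∂μ ≤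
      ((n : ℝ) + 1) * c n + ∫ x, ‖cocycleSum T φ n x‖ ^ 2 ∂μ := by
    intro n
    rw [integral_norm_cocycleSum_succ_sq hT hφm hφ n]
    have h1 : ‖∫ x, cocycleSum T φ n x ∂μ‖ ≤
        ((n : ℝ) + 1) * ‖(1 / (n : ℂ)) * ∫ x, cocycleSum T φ n x ∂μ‖ := by
      rcases Nat.eq_zero_or_pos n with rfl | hn
      · simp [cocycleSum]
      · have hn' : (0 : ℝ) < n := by exact_mod_cast hn
        rw [norm_mul, norm_div, norm_one, Complex.norm_natCast, ← mul_assoc]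
        refine le_mul_of_one_le_left (norm_nonneg _) ?_
        rw [mul_one_div, le_div_iff₀ hn']
        linarith
    have h2 := (le_abs_self _).trans (Complex.abs_re_le_norm (∫ x, cocycleSum T φ n x ∂μ))
    have h3 : ((n : ℝ) + 1) * c n =
        1 + 2 * (((n : ℝ) + 1) * ‖(1 / (n : ℂ)) * ∫ x, cocycleSum T φ n x ∂μ‖) := by
      have : (n : ℝ) + 1 ≠ 0 := by positivity
      simp only [c]
      field_simp
    rw [h3]
    linarith
  have hc0 : ∀ n, 0 ≤ c n := fun n => by positivity
  have hsum : ∀ n : ℕ, ∫ x, ‖cocycleSum T φ n x‖ ^ 2 ∂μ ≤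
      (n : ℝ) * ∑ j ∈ Finset.range n, c j := by
    intro n
    induction n with
    | zero => simp [cocycleSum]
    | succ n ih =>
      have := Finset.sum_nonneg fun j (_ : j ∈ Finset.range n) => hc0 j
      rw [Finset.sum_range_succ]
      push_cast
      nlinarith [hstep n]
  refine squeeze_zero (fun n => by positivity) (fun n => ?_) hc.cesaro
  rcases Nat.eq_zero_or_pos n with rfl | hn
  · simp
  · have hn' : (0 : ℝ) < n := by exact_mod_cast hn
    rw [div_le_iff₀ (by positivity)]
    refine (hsum n).trans (le_of_eq ?_)
    field_simp

theorem tendsto_integral_norm_cocycleSum_div [IsProbabilityMeasure μ]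
    (hT : MeasurePreserving T μ μ) (hφm : Measurable φ) (hφ : ∀ x, ‖φ x‖ = 1)
    (h : Tendsto (fun n : ℕ => (1 / (n : ℂ)) * ∫ x, cocycleSum T φ n x ∂μ) atTop (𝓝 0)) :
    Tendsto (fun n : ℕ => (∫ x, ‖cocycleSum T φ n x‖ ∂μ) / (n : ℝ)) atTop (𝓝 0) := by
  have h1 := (tendsto_integral_norm_cocycleSum_sq_div hT hφm hφ h).sqrt
  rw [Real.sqrt_zero] at h1
  refine squeeze_zero (fun n => by positivity) (fun n => ?_) h1
  refine Real.le_sqrt_of_sq_le ?_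
  rw [div_pow]
  refine div_le_div_of_nonneg_right ?_ (by positivity)
  have hi := (integrable_cocycleSum (μ := μ) hT.measurable hφm hφ n).norm
  have hi2 := integrable_norm_cocycleSum_sq (μ := μ) hT.measurable hφm hφ n
  set m := ∫ x, ‖cocycleSum T φ n x‖ ∂μ
  -- The variance is nonnegative, hence (E|S_n|)² ≤ E|S_n|².
  have h2 : 0 ≤ ∫ x, (‖cocycleSum T φ n x‖ - m) ^ 2 ∂μ := integral_nonneg fun x => sq_nonneg _
  have h3 : ∀ x, (‖cocycleSum T φ n x‖ - m) ^ 2 =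
      ‖cocycleSum T φ n x‖ ^ 2 - 2 * m * ‖cocycleSum T φ n x‖ + m ^ 2 := fun x => by ring
  simp only [h3] at h2
  have hi3 : Integrable (fun x => ‖cocycleSum T φ n x‖ ^ 2 - 2 * m * ‖cocycleSum T φ n x‖) μ :=
    hi2.sub (hi.const_mul _)
  rw [integral_add hi3 (integrable_const _), integral_sub hi2 (hi.const_mul _),
    integral_const_mul] at h2
  simp only [integral_const, probReal_univ, one_smul] at h2
  nlinarith

/-- The event that |S_L| > 2cL for infinitely many L does not involve K, while its bound E|S_K|/(cK)
tends to 0 with K; so it is null. -/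
theorem ae_tendsto_cocycleSum_div [IsProbabilityMeasure μ]
    (hT : MeasurePreserving T μ μ) (hφm : Measurable φ) (hφ : ∀ x, ‖φ x‖ = 1)
    (h : Tendsto (fun n : ℕ => (1 / (n : ℂ)) * ∫ x, cocycleSum T φ n x ∂μ) atTop (𝓝 0)) :
    ∀ᵐ x ∂μ, Tendsto (fun n : ℕ => (1 / (n : ℂ)) * cocycleSum T φ n x) atTop (𝓝 0) := by
  have key : ∀ c : ℝ, 0 < c → ∀ᵐ x ∂μ, ∀ᶠ L : ℕ in atTop, ‖cocycleSum T φ L x‖ ≤ 2 * c * L := by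
    intro c hc
    have hbound : ∀ᶠ K : ℕ in atTop,
        μ {x | ¬ ∀ᶠ L : ℕ in atTop, ‖cocycleSum T φ L x‖ ≤ 2 * c * L} ≤
          ENNReal.ofReal ((∫ x, ‖cocycleSum T φ K x‖ ∂μ) / (K : ℝ) / c) := by
      filter_upwards [eventually_gt_atTop 0] with K hK
      have hK' : (0 : ℝ) < K := by exact_mod_cast hK
      rw [div_div]
      refine (measure_mono ?_).trans (measure_exists_lt_birkhoffSum_le hT
        (measurable_cocycleSum hT.measurable hφm K).norm
        (integrable_cocycleSum hT.measurable hφm hφ K).norm (fun x => norm_nonneg _)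
        (mul_pos hK' hc))
      intro x hx
      have hx' : ∃ᶠ L : ℕ in atTop, ¬ ‖cocycleSum T φ L x‖ ≤ 2 * c * L :=
        not_eventually.1 hx
      -- L ≥ 2K/c makes the window error 2K² at most cKL, so the Birkhoff sum of |S_K| exceeds 2cKL
      -- - cKL = L(Kc).
      obtain ⟨L, hL1, hL2⟩ := (hx'.and_eventually
        (tendsto_natCast_atTop_atTop.eventually_ge_atTop (2 * (K : ℝ) / c))).exists
      refine ⟨L, ?_⟩
      have h1 := mul_norm_cocycleSum_le (T := T) hφ K L x
      rw [div_le_iff₀ hc] at hL2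
      rw [not_le] at hL1
      nlinarith [mul_lt_mul_of_pos_left hL1 hK', mul_le_mul_of_nonneg_left hL2 hK'.le]
    have hlim : Tendsto (fun K : ℕ =>
        ENNReal.ofReal ((∫ x, ‖cocycleSum T φ K x‖ ∂μ) / (K : ℝ) / c)) atTop (𝓝 0) := by
      simpa using ENNReal.tendsto_ofReal
        ((tendsto_integral_norm_cocycleSum_div hT hφm hφ h).div_const c)
    exact le_antisymm (ge_of_tendsto hlim hbound) zero_le
  have hall : ∀ᵐ x ∂μ, ∀ m : ℕ, ∀ᶠ L : ℕ in atTop,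
      ‖cocycleSum T φ L x‖ ≤ 2 * (1 / ((m : ℝ) + 1)) * L :=
    ae_all_iff.2 fun m => key _ (by positivity)
  filter_upwards [hall] with x hx
  rw [Metric.tendsto_atTop']
  intro ε hε
  obtain ⟨m, hm⟩ := exists_nat_one_div_lt (half_pos hε)
  obtain ⟨N, hN⟩ := eventually_atTop.1 (hx m)
  refine ⟨N, fun n hn => ?_⟩
  have hn0 : (0 : ℝ) < n := by exact_mod_cast (Nat.zero_le N).trans_lt hn
  rw [dist_zero_right, norm_mul, norm_div, norm_one, Complex.norm_natCast, one_div_mul_eq_div,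
    div_lt_iff₀ hn0]
  nlinarith [hN n hn.le]

end Cocycle

/-! ### The characters e_h -/

section Exponentials

theorem e_eq_exp (h : ℤ) (x : ℝ) :
    e h x = Complex.exp (Complex.I * ((2 * Real.pi * h * x : ℝ) : ℂ)) := by
  rw [e]
  congr 1
  push_cast
  ring

theorem norm_e (h : ℤ) (x : ℝ) : ‖e h x‖ = 1 := by
  rw [e_eq_exp, mul_comm, Complex.norm_exp_ofReal_mul_I]

theorem e_add (h : ℤ) (x y : ℝ) : e h (x + y) = e h x * e h y := by
  rw [e, e, e, ← Complex.exp_add]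
  congr 1
  push_cast
  ring

theorem e_sum {ι : Type*} (h : ℤ) (s : Finset ι) (x : ι → ℝ) :
    e h (∑ i ∈ s, x i) = ∏ i ∈ s, e h (x i) := by
  simp only [e]
  rw [← Complex.exp_sum]
  push_cast
  rw [Finset.mul_sum]

theorem e_intCast (h k : ℤ) : e h k = 1 := by
  rw [e, Complex.exp_eq_one_iff]
  exact ⟨h * k, by push_cast; ring⟩

theorem e_fract (h : ℤ) (x : ℝ) : e h (Int.fract x) = e h x := by
  conv_rhs => rw [← Int.fract_add_floor x, e_add, e_intCast, mul_one]

theorem e_neg (h : ℤ) (x : ℝ) : e (-h) x = (starRingEnd ℂ) (e h x) := by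
  rw [e, e, ← Complex.exp_conj]
  congr 1
  simp only [map_mul, Complex.conj_I, Complex.conj_ofReal, map_intCast, map_ofNat, Int.cast_neg]
  ring

theorem norm_e_sub_e_le (h : ℤ) (x y : ℝ) :
    ‖e h x - e h y‖ ≤ 2 * Real.pi * |(h : ℝ)| * |x - y| := by
  have h1 : e h x - e h y = e h y * (e h (x - y) - 1) := by
    rw [mul_sub, ← e_add]
    simp
  rw [h1, norm_mul, norm_e, one_mul, e_eq_exp]
  refine Real.norm_exp_I_mul_ofReal_sub_one_le.trans (le_of_eq ?_)
  rw [Real.norm_eq_abs, abs_mul, abs_mul, abs_of_pos Real.two_pi_pos]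

theorem measurable_e (h : ℤ) : Measurable (e h) := by
  unfold e
  fun_prop

/-- A geometric sum whose ratio is a K-th root of unity, different from 1 because K does not divide
h. -/
theorem sum_e_div_eq_zero {h : ℤ} {K : ℕ} (h0 : 0 < h) (hK : h < K) :
    ∑ j ∈ Finset.range K, e h ((j : ℝ) / K) = 0 := by
  have hK0 : (K : ℂ) ≠ 0 := by
    have : (0 : ℤ) < K := h0.trans hK
    exact_mod_cast this.ne'
  have hpow : ∀ j : ℕ, e h ((j : ℝ) / K) = e h (1 / K) ^ j := by
    intro j
    rw [e, e, ← Complex.exp_nat_mul]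
    congr 1
    push_cast
    ring
  have hne : e h (1 / K) ≠ 1 := by
    intro heq
    rw [e, Complex.exp_eq_one_iff] at heq
    obtain ⟨n, hn⟩ := heq
    have h1 : (h : ℂ) = n * K := by
      push_cast at hn
      have h2 := Complex.two_pi_I_ne_zero
      field_simp at hn
      linear_combination hn
    have h2 : h = n * K := by exact_mod_cast h1
    have h3 : 0 < n := by
      by_contra hn0
      nlinarith
    nlinarith
  have hK1 : e h (1 / K) ^ K = 1 := by
    rw [← hpow]
    have : ((K : ℝ) / K) = ((1 : ℤ) : ℝ) := by
      rw [div_self (by exact_mod_cast hK0)]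
      simp
    rw [this, e_intCast]
  simp only [hpow]
  rw [geom_sum_eq hne, hK1]
  simp

end Exponentials

/-! ### Weyl's criterion: from frequencies to exponential sums -/

section Weyl

/-- The fraction of indices `1 ≤ n ≤ N` with fractional part of `x n` in `[0, t)`. -/
noncomputable def fractFreq (x : ℕ → ℝ) (t : ℝ) (N : ℕ) : ℝ :=
  (1 / (N : ℝ)) * ∑ n ∈ Finset.Icc 1 N, if Int.fract (x n) < t then 1 else 0

theorem fractFreq_one (x : ℕ → ℝ) {N : ℕ} (hN : N ≠ 0) : fractFreq x 1 N = 1 := by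
  simp [fractFreq, Int.fract_lt_one, hN]

/-- The difference of the two indicators is that of the cell [j/K, (j+1)/K), so only the cell
containing the fractional part of y survives. -/
theorem sum_e_mul_ite_eq {h : ℤ} {K : ℕ} (hK : 0 < K) (y : ℝ) :
    ∑ j ∈ Finset.range K, e h ((j : ℝ) / K) *
      (((if Int.fract y < ((j + 1 : ℕ) : ℝ) / K then 1 else 0 : ℝ) : ℂ) -
        ((if Int.fract y < (j : ℝ) / K then 1 else 0 : ℝ) : ℂ)) =
      e h ((⌊K * Int.fract y⌋₊ : ℝ) / K) := by
  have hK' : (0 : ℝ) < K := by exact_mod_cast hK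
  have hf0 : 0 ≤ K * Int.fract y := mul_nonneg hK'.le (Int.fract_nonneg y)
  have hmem : ⌊K * Int.fract y⌋₊ ∈ Finset.range K := by
    rw [Finset.mem_range, Nat.floor_lt hf0]
    nlinarith [Int.fract_lt_one y]
  rw [Finset.sum_eq_single_of_mem _ hmem]
  · have h1 : Int.fract y < ((⌊K * Int.fract y⌋₊ + 1 : ℕ) : ℝ) / K := by
      rw [lt_div_iff₀ hK', mul_comm]
      push_cast
      exact Nat.lt_floor_add_one _
    have h2 : ¬ Int.fract y < (⌊K * Int.fract y⌋₊ : ℝ) / K := by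
      rw [not_lt, div_le_iff₀ hK', mul_comm (Int.fract y)]
      exact Nat.floor_le hf0
    rw [if_pos h1, if_neg h2]
    simp
  · intro j _ hj
    have hiff : (Int.fract y < ((j + 1 : ℕ) : ℝ) / K) ↔ Int.fract y < (j : ℝ) / K := by
      rw [lt_div_iff₀ hK', lt_div_iff₀ hK', mul_comm (Int.fract y), ← Nat.floor_lt hf0,
        ← Nat.floor_lt hf0]
      omega
    simp only [hiff, sub_self, mul_zero]

/-- The easy direction of Weyl's criterion. -/
theorem tendsto_weyl_of_tendsto_fractFreq {x : ℕ → ℝ}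
    (hx : ∀ t : ℝ, 0 ≤ t → t < 1 → Tendsto (fractFreq x t) atTop (𝓝 t)) {h : ℤ} (h0 : 0 < h) :
    Tendsto (fun N : ℕ => (1 / (N : ℂ)) * ∑ n ∈ Finset.Icc 1 N, e h (x n)) atTop (𝓝 0) := by
  -- The value t = 1 is the right end of the last cell.
  have hx1 : ∀ t : ℝ, 0 ≤ t → t ≤ 1 → Tendsto (fractFreq x t) atTop (𝓝 t) := by
    intro t ht0 ht1
    rcases ht1.lt_or_eq with ht | rfl
    · exact hx t ht0 ht
    · refine tendsto_const_nhds.congr' ?_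
      filter_upwards [eventually_ne_atTop 0] with N hN
      exact (fractFreq_one x hN).symm
  rw [Metric.tendsto_atTop']
  intro ε hε
  -- K makes the cost of rounding fractional parts down to multiples of 1/K less than ε/2, and K > h
  -- makes the limiting Riemann sum of e_h vanish.
  obtain ⟨K, hK1, hK2, hK3⟩ := ((tendsto_natCast_atTop_atTop (R := ℝ)).eventually_gt_atTop
    (2 * Real.pi * |(h : ℝ)| / (ε / 2)) |>.and
    ((tendsto_natCast_atTop_atTop (R := ℤ)).eventually_gt_atTop h |>.and
      (eventually_gt_atTop 0))).exists
  have hK : (0 : ℝ) < K := by exact_mod_cast hK3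
  have hlim : Tendsto (fun N => ∑ j ∈ Finset.range K, e h ((j : ℝ) / K) *
      ((fractFreq x (((j + 1 : ℕ) : ℝ) / K) N : ℂ) - (fractFreq x ((j : ℝ) / K) N : ℂ)))
      atTop (𝓝 0) := by
    have hz : ∑ j ∈ Finset.range K, e h ((j : ℝ) / K) *
        (((((j + 1 : ℕ) : ℝ) / K : ℝ) : ℂ) - (((j : ℝ) / K : ℝ) : ℂ)) = 0 := by
      have : ∀ j ∈ Finset.range K, e h ((j : ℝ) / K) *
        (((((j + 1 : ℕ) : ℝ) / K : ℝ) : ℂ) - (((j : ℝ) / K : ℝ) : ℂ)) =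
          e h ((j : ℝ) / K) * (1 / K) := by
        intro j _
        congr 1
        push_cast
        ring
      rw [Finset.sum_congr rfl this, ← Finset.sum_mul, sum_e_div_eq_zero h0 hK2, zero_mul]
    rw [← hz]
    refine tendsto_finsetSum _ fun j hj => Tendsto.const_mul _ ?_
    have hjK : ((j + 1 : ℕ) : ℝ) ≤ K := by exact_mod_cast Finset.mem_range.1 hj
    have hj1 : ((j + 1 : ℕ) : ℝ) / K ≤ 1 := (div_le_one hK).2 hjK
    have hj2 : (j : ℝ) / K ≤ 1 := (div_le_one hK).2 (by push_cast at hjK; linarith)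
    exact ((Complex.continuous_ofReal.tendsto _).comp (hx1 _ (by positivity) hj1)).sub
      ((Complex.continuous_ofReal.tendsto _).comp (hx1 _ (by positivity) hj2))
  obtain ⟨N₀, hN₀⟩ := (Metric.tendsto_atTop'.1 hlim) (ε / 2) (half_pos hε)
  refine ⟨N₀, fun N hN => ?_⟩
  have h1 := hN₀ N hN
  have hN0 : (0 : ℝ) < N := by exact_mod_cast (Nat.zero_le N₀).trans_lt hN
  rw [dist_zero_right] at h1 ⊢
  have h2 : ∑ j ∈ Finset.range K, e h ((j : ℝ) / K) *
      ((fractFreq x (((j + 1 : ℕ) : ℝ) / K) N : ℂ) - (fractFreq x ((j : ℝ) / K) N : ℂ)) =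
      (1 / (N : ℂ)) * ∑ n ∈ Finset.Icc 1 N, e h ((⌊K * Int.fract (x n)⌋₊ : ℝ) / K) := by
    simp_rw [← sum_e_mul_ite_eq hK3]
    rw [Finset.sum_comm, Finset.mul_sum]
    refine Finset.sum_congr rfl fun j _ => ?_
    rw [← Finset.mul_sum, Finset.sum_sub_distrib, fractFreq, fractFreq]
    push_cast
    ring
  have h3 : ‖(1 / (N : ℂ)) * ∑ n ∈ Finset.Icc 1 N, e h (x n) -
      (1 / (N : ℂ)) * ∑ n ∈ Finset.Icc 1 N, e h ((⌊K * Int.fract (x n)⌋₊ : ℝ) / K)‖ ≤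
        2 * Real.pi * |(h : ℝ)| / K := by
    rw [← mul_sub, ← Finset.sum_sub_distrib, norm_mul, norm_div, norm_one, Complex.norm_natCast,
      one_div_mul_eq_div, div_le_iff₀ hN0]
    have hb : ∀ n ∈ Finset.Icc 1 N, ‖e h (x n) - e h ((⌊K * Int.fract (x n)⌋₊ : ℝ) / K)‖ ≤
        2 * Real.pi * |(h : ℝ)| / K := by
      intro n _
      rw [← e_fract h (x n)]
      refine (norm_e_sub_e_le _ _ _).trans ?_
      rw [div_eq_mul_inv (2 * Real.pi * |(h : ℝ)|)]
      refine mul_le_mul_of_nonneg_left ?_ (by positivity)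
      have hf0 : 0 ≤ K * Int.fract (x n) := mul_nonneg hK.le (Int.fract_nonneg _)
      have e1 := Nat.floor_le hf0
      have e2 := Nat.lt_floor_add_one (K * Int.fract (x n))
      have e3 : Int.fract (x n) - (⌊K * Int.fract (x n)⌋₊ : ℝ) / K =
          (K * Int.fract (x n) - ⌊K * Int.fract (x n)⌋₊) / K := by field_simp
      rw [e3, abs_of_nonneg (div_nonneg (by linarith) hK.le)]
      rw [← one_div]
      exact div_le_div_of_nonneg_right (by linarith) hK.le
    refine (norm_sum_le_of_le _ hb).trans (le_of_eq ?_)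
    rw [Finset.sum_const, Nat.card_Icc, nsmul_eq_mul]
    simp [mul_comm]
  have h4 : 2 * Real.pi * |(h : ℝ)| / K < ε / 2 := by
    rw [div_lt_iff₀ (half_pos hε)] at hK1
    rw [div_lt_iff₀ hK]
    linarith
  rw [h2] at h1
  have h5 := norm_sub_norm_le ((1 / (N : ℂ)) * ∑ n ∈ Finset.Icc 1 N, e h (x n))
    ((1 / (N : ℂ)) * ∑ n ∈ Finset.Icc 1 N, e h ((⌊K * Int.fract (x n)⌋₊ : ℝ) / K))
  linarith

/-! ### Weyl's criterion: from exponential sums to frequencies, by weak convergence on the circle -/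

instance isProbabilityMeasure_volume_unitAddCircle :
    IsProbabilityMeasure (volume : Measure UnitAddCircle) :=
  ⟨UnitAddCircle.measure_univ⟩

theorem fourier_coe_eq_e (h : ℤ) (x : ℝ) : fourier h (x : UnitAddCircle) = e h x := by
  rw [fourier_coe_apply, e]
  congr 1
  push_cast
  ring

theorem integral_fourier_eq_zero {h : ℤ} (h0 : h ≠ 0) :
    ∫ y : UnitAddCircle, fourier h y = 0 := by
  have h1 := congrFun (fourierCoeff_fourier (T := (1 : ℝ)) h) 0
  rw [fourierCoeff, AddCircle.integral_haarAddCircle, Pi.single_eq_of_ne h0.symm] at h1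
  simpa only [neg_zero, fourier_zero, one_smul, inv_one] using h1

/-- The empirical measure on the circle of the first `N` terms of a sequence. -/
noncomputable def empiricalMeasure (x : ℕ → ℝ) (N : ℕ) : Measure UnitAddCircle :=
  ENNReal.ofReal (1 / (N : ℝ)) • ∑ n ∈ Finset.Icc 1 N, Measure.dirac (x n : UnitAddCircle)

theorem isProbabilityMeasure_empiricalMeasure (x : ℕ → ℝ) {N : ℕ} (hN : N ≠ 0) :
    IsProbabilityMeasure (empiricalMeasure x N) := by
  constructor
  have hN0 : (0 : ℝ) < N := by exact_mod_cast Nat.pos_of_ne_zero hN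
  rw [empiricalMeasure, Measure.smul_apply, Measure.finsetSum_apply]
  simp only [measure_univ, Finset.sum_const, Nat.card_Icc, smul_eq_mul, nsmul_eq_mul, mul_one,
    Nat.add_sub_cancel]
  rw [← ENNReal.ofReal_natCast, ← ENNReal.ofReal_mul (by positivity), one_div,
    inv_mul_cancel₀ hN0.ne', ENNReal.ofReal_one]

theorem integral_empiricalMeasure (x : ℕ → ℝ) (N : ℕ) (f : C(UnitAddCircle, ℂ)) :
    ∫ y, f y ∂(empiricalMeasure x N) = (1 / (N : ℂ)) * ∑ n ∈ Finset.Icc 1 N, f (x n) := by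
  rw [empiricalMeasure, integral_smul_measure, integral_finsetSum_measure]
  · simp only [integral_dirac]
    rw [ENNReal.toReal_ofReal (by positivity), Complex.real_smul]
    push_cast
    rfl
  · intro n _
    exact integrable_dirac (by simp)

/-- The arc `[0, t)` of the circle. -/
def arc (t : ℝ) : Set UnitAddCircle :=
  {y | (AddCircle.measurableEquivIco 1 0 y : ℝ) < t}

theorem measurableSet_arc (t : ℝ) : MeasurableSet (arc t) :=
  measurableSet_lt (measurable_subtype_coe.comp (AddCircle.measurableEquivIco 1 0).measurable)
    measurable_const

theorem coe_mem_arc_iff {t x : ℝ} : (x : UnitAddCircle) ∈ arc t ↔ Int.fract x < t := by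
  have h : ((AddCircle.measurableEquivIco 1 0 (x : UnitAddCircle) : Set.Ico (0 : ℝ) (0 + 1)) : ℝ) =
      Int.fract x := by
    have := AddCircle.coe_equivIco_mk_apply (1 : ℝ) x
    rw [div_one, mul_one] at this
    exact this
  rw [arc, Set.mem_ofPred_eq, h]

theorem arc_eq_image {t : ℝ} (ht1 : t < 1) :
    arc t = (fun x : ℝ => (x : UnitAddCircle)) '' Set.Ico 0 t := by
  ext y
  induction y using QuotientAddGroup.induction_on with
  | H x =>
    rw [show ((QuotientAddGroup.mk x : UnitAddCircle) ∈ arc t) ↔ _ from coe_mem_arc_iff]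
    constructor
    · intro hx
      refine ⟨Int.fract x, ⟨Int.fract_nonneg x, hx⟩, ?_⟩
      exact AddCircle.coe_fract x
    · rintro ⟨z, hz, hzx⟩
      have h1 : (z : UnitAddCircle) ∈ arc t := by
        rw [coe_mem_arc_iff, Int.fract_eq_self.2 ⟨hz.1, hz.2.trans ht1⟩]
        exact hz.2
      have h2 : (z : UnitAddCircle) = (x : UnitAddCircle) := hzx
      rwa [h2, coe_mem_arc_iff] at h1

theorem volume_arc {t : ℝ} (ht1 : t < 1) : volume (arc t) = ENNReal.ofReal t := by
  rw [← (UnitAddCircle.measurePreserving_mk 0).measure_preimage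
    (measurableSet_arc t).nullMeasurableSet, Measure.restrict_apply
    ((UnitAddCircle.measurePreserving_mk 0).measurable (measurableSet_arc t))]
  -- The fundamental domain is (0, 1] but the arc is read in [0, 1); the endpoints are discarded as
  -- null.
  have h1 : ∀ᵐ x : ℝ, x ≠ 0 := by simp [ae_iff]
  have h2 : ∀ᵐ x : ℝ, x ≠ 1 := by simp [ae_iff]
  have h3 : (((↑) : ℝ → UnitAddCircle) ⁻¹' arc t ∩ Set.Ioc 0 (0 + 1) : Set ℝ) =ᵐ[volume]
      Set.Ico 0 t := by
    refine eventuallyEq_set.2 ?_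
    filter_upwards [h1, h2] with x hx0 hx1
    rw [Set.mem_inter_iff, Set.mem_preimage, coe_mem_arc_iff, zero_add]
    constructor
    · rintro ⟨hx, hx2, hx3⟩
      rw [Int.fract_eq_self.2 ⟨hx2.le, lt_of_le_of_ne hx3 hx1⟩] at hx
      exact ⟨hx2.le, hx⟩
    · rintro ⟨hx, hxt⟩
      refine ⟨?_, lt_of_le_of_ne hx hx0.symm, (hxt.trans ht1).le⟩
      rwa [Int.fract_eq_self.2 ⟨hx, hxt.trans ht1⟩]
  rw [measure_congr h3, Real.volume_Ico, sub_zero]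

/-- The frontier lies in the two endpoints: the image of [0, t] is closed and that of (0, t) is
open. This allows weak convergence to be tested on arcs. -/
theorem volume_frontier_arc {t : ℝ} (ht1 : t < 1) : volume (frontier (arc t)) = 0 := by
  have hcont : Continuous ((↑) : ℝ → UnitAddCircle) := AddCircle.continuous_mk' 1
  have hsub : frontier (arc t) ⊆ {((0 : ℝ) : UnitAddCircle), (t : UnitAddCircle)} := by
    intro y hy
    have hcl : y ∈ ((↑) : ℝ → UnitAddCircle) '' Set.Icc 0 t := by
      refine closure_minimal ?_ (isCompact_Icc.image hcont).isClosed hy.1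
      rw [arc_eq_image ht1]
      exact Set.image_mono Set.Ico_subset_Icc_self
    obtain ⟨z, hz, rfl⟩ := hcl
    have hint : ((↑) : ℝ → UnitAddCircle) '' Set.Ioo 0 t ⊆ interior (arc t) := by
      refine interior_maximal ?_ (QuotientAddGroup.isOpenMap_coe _ isOpen_Ioo)
      rw [arc_eq_image ht1]
      exact Set.image_mono Set.Ioo_subset_Ico_self
    rcases hz.1.eq_or_lt with h | h
    · exact Or.inl (by rw [h])
    · rcases hz.2.eq_or_lt with h' | h'
      · exact Or.inr (by rw [h']; rfl)
      · exact absurd (hint ⟨z, ⟨h, h'⟩, rfl⟩) hy.2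
  refine measure_mono_null hsub ?_
  have hpt : ∀ y : UnitAddCircle, volume {y} = 0 := by
    intro y
    rw [← Metric.closedBall_zero, AddCircle.volume_closedBall]
    simp
  rw [Set.insert_eq]
  exact measure_union_null (hpt _) (hpt _)

theorem empiricalMeasure_arc (x : ℕ → ℝ) (N : ℕ) (t : ℝ) :
    (empiricalMeasure x N (arc t)).toReal = fractFreq x t N := by
  rw [empiricalMeasure, Measure.smul_apply, Measure.finsetSum_apply, smul_eq_mul,
    ENNReal.toReal_mul, ENNReal.toReal_ofReal (by positivity),
    ENNReal.toReal_sum (fun _ _ => measure_ne_top _ _), fractFreq]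
  congr 1
  refine Finset.sum_congr rfl fun n _ => ?_
  rw [Measure.dirac_apply' _ (measurableSet_arc t)]
  by_cases h : Int.fract (x n) < t
  · rw [Set.indicator_of_mem (coe_mem_arc_iff.2 h), if_pos h]
    simp
  · rw [Set.indicator_of_notMem (fun h' => h (coe_mem_arc_iff.1 h')), if_neg h]
    simp

/-- The hard direction of Weyl's criterion. -/
theorem tendsto_fractFreq_of_tendsto_weyl {x : ℕ → ℝ}
    (hx : ∀ h : ℤ, 0 < h →
      Tendsto (fun N : ℕ => (1 / (N : ℂ)) * ∑ n ∈ Finset.Icc 1 N, e h (x n)) atTop (𝓝 0))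
    {t : ℝ} (ht0 : 0 ≤ t) (ht1 : t < 1) : Tendsto (fractFreq x t) atTop (𝓝 t) := by
  -- Negative frequencies follow by complex conjugation.
  have hx' : ∀ h : ℤ, h ≠ 0 →
      Tendsto (fun N : ℕ => (1 / (N : ℂ)) * ∑ n ∈ Finset.Icc 1 N, e h (x n)) atTop (𝓝 0) := by
    intro h hh
    rcases lt_or_gt_of_ne hh with hneg | hpos
    · have h1 := (Complex.continuous_conj.tendsto 0).comp (hx (-h) (by omega))
      rw [map_zero] at h1
      refine h1.congr fun N => ?_
      have h2 : ∀ n, e h (x n) = (starRingEnd ℂ) (e (-h) (x n)) := by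
        intro n
        rw [← e_neg, neg_neg]
      simp [h2, Function.comp]
    · exact hx h hpos
  -- The index is shifted because the empirical measure of zero terms is 0.
  let m : ℕ → ProbabilityMeasure UnitAddCircle := fun N =>
    ⟨empiricalMeasure x (N + 1), isProbabilityMeasure_empiricalMeasure x N.succ_ne_zero⟩
  let m₀ : ProbabilityMeasure UnitAddCircle := ⟨volume, inferInstance⟩
  have hspan : ∀ f ∈ Submodule.span ℂ (Set.range (@fourier 1)),
      Tendsto (fun N => ∫ y, f y ∂(empiricalMeasure x (N + 1))) atTop
        (𝓝 (∫ y : UnitAddCircle, f y)) := by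
    intro f hf
    have hint : ∀ (ν : Measure UnitAddCircle) [IsFiniteMeasure ν] (f : C(UnitAddCircle, ℂ)),
        Integrable f ν := fun ν _ f =>
      (BoundedContinuousFunction.mkOfCompact f).integrable ν
    induction hf using Submodule.span_induction with
    | mem f hf =>
      obtain ⟨h, rfl⟩ := hf
      simp_rw [integral_empiricalMeasure, fourier_coe_eq_e]
      rcases eq_or_ne h 0 with rfl | hh
      · have h1 : ∀ N : ℕ, (1 / ((N + 1 : ℕ) : ℂ)) *
            ∑ n ∈ Finset.Icc 1 (N + 1), e 0 (x n) = 1 := by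
          intro N
          have : ((N : ℂ) + 1) ≠ 0 := by exact_mod_cast N.succ_ne_zero
          simp [e, this]
        have h2 : ∫ y : UnitAddCircle, fourier 0 y = 1 := by simp
        simp only [h1, h2]
        exact tendsto_const_nhds
      · rw [integral_fourier_eq_zero hh]
        exact (hx' h hh).comp (tendsto_add_atTop_nat 1)
    | zero => simp
    | add f g _ _ hf hg =>
      have h1 : ∀ (ν : Measure UnitAddCircle) [IsFiniteMeasure ν],
          ∫ y, (f + g) y ∂ν = ∫ y, f y ∂ν + ∫ y, g y ∂ν := fun ν _ =>
        integral_add (hint ν f) (hint ν g)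
      rw [h1]
      refine (hf.add hg).congr fun N => ?_
      have := isProbabilityMeasure_empiricalMeasure x N.succ_ne_zero
      exact (h1 _).symm
    | smul c f _ hf =>
      have h1 : ∀ ν : Measure UnitAddCircle, ∫ y, (c • f) y ∂ν = c • ∫ y, f y ∂ν := fun ν =>
        integral_smul c f
      simp only [h1]
      exact hf.const_smul c
  -- Trigonometric polynomials form a star subalgebra separating points, and tightness is free on a
  -- compact space, so convergence of their integrals gives weak convergence.
  have hm : Tendsto m atTop (𝓝 m₀) := by
    refine ProbabilityMeasure.tendsto_of_tight_of_separatesPoints ℂ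
      IsTightMeasureSet.of_compactSpace
      (A := (fourierSubalgebra (T := 1)).comap
        (BoundedContinuousFunction.toContinuousMapStarₐ ℂ)) ?_ ?_
    · intro y z hyz
      obtain ⟨_, ⟨f, hf, rfl⟩, hne⟩ := fourierSubalgebra_separatesPoints (T := 1) hyz
      exact ⟨f, ⟨f, ⟨BoundedContinuousFunction.mkOfCompact f, hf, rfl⟩, rfl⟩, hne⟩
    · intro g hg
      refine hspan g.toContinuousMap ?_
      rw [← fourierSubalgebra_coe]
      exact hg
  have hE := ProbabilityMeasure.tendsto_measure_of_null_frontier_of_tendsto' hm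
    (E := arc t) (volume_frontier_arc ht1)
  have hE' := (ENNReal.tendsto_toReal (measure_ne_top _ _)).comp hE
  have hlim : ((m₀ : Measure UnitAddCircle) (arc t)).toReal = t := by
    rw [show ((m₀ : Measure UnitAddCircle) (arc t)) = volume (arc t) from rfl,
      volume_arc ht1, ENNReal.toReal_ofReal ht0]
  rw [hlim] at hE'
  refine (tendsto_add_atTop_iff_nat 1).1 (hE'.congr fun N => ?_)
  exact empiricalMeasure_arc x (N + 1) t

end Weyl

/-! ### Mantissae as fractional parts of logarithms -/

section Mantissa

theorem mantissa_mem_Ico_iff {b u a : ℝ} (hb : 1 < b) (hu : 0 < u) (ha : 1 ≤ a) :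
    mantissa b u ∈ Set.Ico 1 a ↔ Int.fract (Real.logb b u) < Real.logb b a := by
  have hb0 : 0 < b := by linarith
  have hm := (mantissa_mem hb hu).1
  have hm0 : 0 < mantissa b u := by linarith
  have hlog : Real.logb b (mantissa b u) = Int.fract (Real.logb b u) := by
    rw [mantissa, Real.logb_div hu.ne' (zpow_ne_zero _ hb0.ne'), ← Real.rpow_intCast,
      Real.logb_rpow hb0 hb.ne', Int.fract]
  rw [← hlog, Real.logb_lt_logb_iff hb hm0 (by linarith)]
  exact ⟨fun h => h.2, fun h => ⟨hm, h⟩⟩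

theorem isBenford_iff_tendsto_fractFreq {b : ℝ} (hb : 1 < b) {u : ℕ → ℝ}
    (hu : ∀ n, 1 ≤ n → 0 < u n) :
    IsBenford b u ↔ ∀ t : ℝ, 0 ≤ t → t < 1 →
      Tendsto (fractFreq (fun n => Real.logb b (u n)) t) atTop (𝓝 t) := by
  have hb0 : 0 < b := by linarith
  have key : ∀ a : ℝ, 1 ≤ a → ∀ N : ℕ,
      (1 / (N : ℝ)) * ∑ n ∈ Finset.Icc 1 N,
        Set.indicator (Set.Ico 1 a) (fun _ => (1 : ℝ)) (mantissa b (u n)) =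
      fractFreq (fun n => Real.logb b (u n)) (Real.logb b a) N := by
    intro a ha N
    rw [fractFreq]
    congr 1
    refine Finset.sum_congr rfl fun n hn => ?_
    have hiff := mantissa_mem_Ico_iff hb (hu n (Finset.mem_Icc.1 hn).1) ha
    by_cases h : mantissa b (u n) ∈ Set.Ico 1 a
    · rw [Set.indicator_of_mem h, if_pos (hiff.1 h)]
    · rw [Set.indicator_of_notMem h, if_neg (fun h' => h (hiff.2 h'))]
  constructor
  · intro h t ht0 ht1
    have ha1 : 1 ≤ b ^ t := Real.one_le_rpow hb.le ht0
    have ha2 : b ^ t < b := by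
      conv_rhs => rw [← Real.rpow_one b]
      exact Real.rpow_lt_rpow_of_exponent_lt hb ht1
    have h1 := h (b ^ t) ha1 ha2
    simp only [key _ ha1, Real.logb_rpow hb0 hb.ne'] at h1
    exact h1
  · intro h a ha1 ha2
    simp only [key a ha1]
    refine h _ (Real.logb_nonneg hb ha1) ?_
    rwa [Real.logb_lt_iff_lt_rpow hb (by linarith), Real.rpow_one]

/-- Weyl's criterion for the Benford property. -/
theorem isBenford_iff_tendsto_weyl {b : ℝ} (hb : 1 < b) {u : ℕ → ℝ}
    (hu : ∀ n, 1 ≤ n → 0 < u n) :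
    IsBenford b u ↔ ∀ h : ℤ, 0 < h →
      Tendsto (fun N : ℕ => (1 / (N : ℂ)) * ∑ n ∈ Finset.Icc 1 N, e h (Real.logb b (u n)))
        atTop (𝓝 0) := by
  rw [isBenford_iff_tendsto_fractFreq hb hu]
  exact ⟨fun h _ h0 => tendsto_weyl_of_tendsto_fractFreq h h0,
    fun h _ ht0 ht1 => tendsto_fractFreq_of_tendsto_weyl h ht0 ht1⟩

end Mantissa

/-! ### Transfer to the shift on sequence space -/

section Stationary

/-- The shift on sequences. -/
def seqShift (x : ℕ → ℝ) : ℕ → ℝ := fun n => x (n + 1)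

theorem iterate_seqShift_apply_zero (k : ℕ) (x : ℕ → ℝ) : seqShift^[k] x 0 = x k := by
  have h : ∀ (k n : ℕ) (x : ℕ → ℝ), seqShift^[k] x n = x (n + k) := by
    intro k
    induction k with
    | zero => intro n x; rfl
    | succ k ih =>
      intro n x
      rw [Function.iterate_succ_apply, ih, seqShift, add_assoc]
  rw [h, zero_add]

theorem measurable_seqShift : Measurable seqShift :=
  measurable_pi_lambda _ fun n => measurable_pi_apply (n + 1)

variable {Ω : Type*} {X : ℕ → Ω → ℝ}

/-- Coordinate k of the sequence carries X_{k+1}. Positivity makes the logarithm of the product a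
sum, which e_h turns into the cocycle. -/
theorem birkhoffProd_seqShift_eq {b : ℝ} (h : ℤ) (n : ℕ) {ω : Ω}
    (hω : ∀ k, 1 ≤ k → 0 < X k ω) :
    birkhoffProd seqShift (fun x => e h (Real.logb b (x 0))) n (fun k => X (k + 1) ω) =
      e h (Real.logb b (prodSeq X n ω)) := by
  rw [prodSeq, Real.logb_prod _ _ fun k hk => (hω k (Finset.mem_Icc.1 hk).1).ne', e_sum,
    birkhoffProd, Finset.range_eq_Ico, ← Finset.Ico_add_one_right_eq_Icc,
    ← Finset.prod_Ico_add' _ 0 n 1]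
  simp only [iterate_seqShift_apply_zero]

theorem cocycleSum_seqShift_eq {b : ℝ} (h : ℤ) (n : ℕ) {ω : Ω}
    (hω : ∀ k, 1 ≤ k → 0 < X k ω) :
    cocycleSum seqShift (fun x => e h (Real.logb b (x 0))) n (fun k => X (k + 1) ω) =
      ∑ l ∈ Finset.Icc 1 n, e h (Real.logb b (prodSeq X l ω)) := by
  rw [cocycleSum, Finset.range_eq_Ico, ← Finset.Ico_add_one_right_eq_Icc,
    ← Finset.sum_Ico_add' _ 0 n 1]
  exact Finset.sum_congr rfl fun l _ => birkhoffProd_seqShift_eq h (l + 1) hω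

variable [MeasurableSpace Ω] {P : Measure Ω}

theorem measurable_shiftedSeq (hmeas : ∀ n, 1 ≤ n → Measurable (X n)) :
    Measurable fun ω (n : ℕ) => X (n + 1) ω :=
  measurable_pi_lambda _ fun n => hmeas (n + 1) (Nat.le_add_left 1 n)

theorem IsStationary.measurePreserving_seqShift (hstat : IsStationary P X)
    (hmeas : ∀ n, 1 ≤ n → Measurable (X n)) :
    MeasurePreserving seqShift (P.map fun ω (n : ℕ) => X (n + 1) ω)
      (P.map fun ω (n : ℕ) => X (n + 1) ω) := by
  refine ⟨measurable_seqShift, ?_⟩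
  rw [Measure.map_map measurable_seqShift (measurable_shiftedSeq hmeas)]
  exact hstat 1

theorem measurable_e_logb_prodSeq (hmeas : ∀ n, 1 ≤ n → Measurable (X n)) (b : ℝ) (h : ℤ)
    (n : ℕ) : Measurable fun ω => e h (Real.logb b (prodSeq X n ω)) := by
  have h1 : Measurable (prodSeq X n) :=
    Finset.measurable_prod _ fun k hk => hmeas k (Finset.mem_Icc.1 hk).1
  exact (measurable_e h).comp ((Real.measurable_log.comp h1).div_const _)

theorem integrable_e_logb_prodSeq [IsFiniteMeasure P] (hmeas : ∀ n, 1 ≤ n → Measurable (X n))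
    (b : ℝ) (h : ℤ) (n : ℕ) : Integrable (fun ω => e h (Real.logb b (prodSeq X n ω))) P :=
  Integrable.of_bound (measurable_e_logb_prodSeq hmeas b h n).aestronglyMeasurable 1
    (Eventually.of_forall fun _ => (norm_e _ _).le)

/-- For a stationary sequence, convergence to zero of the Weyl means of the products holds almost
surely as soon as it holds in expectation. -/
theorem IsStationary.ae_tendsto_weyl [IsProbabilityMeasure P] (hstat : IsStationary P X)
    (hmeas : ∀ n, 1 ≤ n → Measurable (X n)) (hpos : ∀ᵐ ω ∂P, ∀ n, 1 ≤ n → 0 < X n ω)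
    (b : ℝ) (h : ℤ)
    (hlim : Tendsto (fun L : ℕ => (1 / (L : ℂ)) * ∑ l ∈ Finset.Icc 1 L,
      ∫ ω, e h (Real.logb b (prodSeq X l ω)) ∂P) atTop (𝓝 0)) :
    ∀ᵐ ω ∂P, Tendsto (fun L : ℕ => (1 / (L : ℂ)) * ∑ l ∈ Finset.Icc 1 L,
      e h (Real.logb b (prodSeq X l ω))) atTop (𝓝 0) := by
  have hS := measurable_shiftedSeq hmeas
  have : IsProbabilityMeasure (P.map fun ω (n : ℕ) => X (n + 1) ω) :=
    Measure.isProbabilityMeasure_map hS.aemeasurable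
  have hφm : Measurable fun x : ℕ → ℝ => e h (Real.logb b (x 0)) :=
    (measurable_e h).comp ((Real.measurable_log.comp (measurable_pi_apply 0)).div_const _)
  -- The generator has modulus 1 on all of sequence space, as `Real.logb` is total; positivity only
  -- enters when returning to the products.
  have hmain := ae_tendsto_cocycleSum_div (hstat.measurePreserving_seqShift hmeas) hφm
    (fun x => norm_e _ _) ?_
  · filter_upwards [ae_of_ae_map hS.aemeasurable hmain, hpos] with ω hω hωpos
    simpa only [cocycleSum_seqShift_eq h _ hωpos] using hω
  · refine hlim.congr fun L => ?_
    congr 1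
    rw [integral_map hS.aemeasurable
      (measurable_cocycleSum measurable_seqShift hφm L).aestronglyMeasurable,
      ← integral_finsetSum _ fun l _ => integrable_e_logb_prodSeq hmeas b h l]
    refine integral_congr_ae ?_
    filter_upwards [hpos] with ω hωpos
    exact (cocycleSum_seqShift_eq h L hωpos).symm

theorem tendsto_integral_weyl [IsProbabilityMeasure P] (hmeas : ∀ n, 1 ≤ n → Measurable (X n))
    (b : ℝ) (h : ℤ)
    (hlim : ∀ᵐ ω ∂P, Tendsto (fun L : ℕ => (1 / (L : ℂ)) * ∑ l ∈ Finset.Icc 1 L,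
      e h (Real.logb b (prodSeq X l ω))) atTop (𝓝 0)) :
    Tendsto (fun L : ℕ => (1 / (L : ℂ)) * ∑ l ∈ Finset.Icc 1 L,
      ∫ ω, e h (Real.logb b (prodSeq X l ω)) ∂P) atTop (𝓝 0) := by
  have h1 : Tendsto (fun L : ℕ => ∫ ω, (1 / (L : ℂ)) * ∑ l ∈ Finset.Icc 1 L,
      e h (Real.logb b (prodSeq X l ω)) ∂P) atTop (𝓝 (∫ _, 0 ∂P)) := by
    refine tendsto_integral_of_dominated_convergence (fun _ => 1) (fun L => ?_)
      (integrable_const _) (fun L => Eventually.of_forall fun ω => ?_) hlim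
    · exact ((Finset.measurable_sum _ fun l _ =>
        measurable_e_logb_prodSeq hmeas b h l).const_mul _).aestronglyMeasurable
    · have h2 : ‖∑ l ∈ Finset.Icc 1 L, e h (Real.logb b (prodSeq X l ω))‖ ≤ L := by
        refine (norm_sum_le _ _).trans ?_
        simp [norm_e]
      rw [norm_mul, norm_div, norm_one, Complex.norm_natCast, one_div_mul_eq_div]
      exact div_le_one_of_le₀ h2 (Nat.cast_nonneg L)
  rw [integral_zero] at h1
  refine h1.congr fun L => ?_
  rw [integral_const_mul, integral_finsetSum _ fun l _ => integrable_e_logb_prodSeq hmeas b h l]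

end Stationary

end Benford

theorem theorem1 {Ω : Type*} [MeasurableSpace Ω] (P : Measure Ω) [IsProbabilityMeasure P]
    (b : ℝ) (hb : 1 < b) (X : ℕ → Ω → ℝ)
    (hmeas : ∀ n, 1 ≤ n → Measurable (X n))
    (hpos : ∀ n, 1 ≤ n → ∀ᵐ ω ∂P, 0 < X n ω)
    (hstat : Benford.IsStationary P X) :
    Benford.AlmostSurelyBenford P b (Benford.prodSeq X) ↔
      ∀ h : ℤ, 0 < h →
        Tendsto (fun L : ℕ =>
            (1 / (L : ℂ)) * ∑ l ∈ Finset.Icc 1 L,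
              ∫ ω, Benford.e h (Real.logb b (Benford.prodSeq X l ω)) ∂P)
          atTop (𝓝 0) := by
  have hpos' : ∀ᵐ ω ∂P, ∀ n, 1 ≤ n → 0 < X n ω := ae_all_iff.2 fun n => by
    by_cases hn : 1 ≤ n
    · filter_upwards [hpos n hn] with ω hω _ using hω
    · exact Eventually.of_forall fun ω h => absurd h hn
  have hprod : ∀ ω, (∀ n, 1 ≤ n → 0 < X n ω) → ∀ n, 1 ≤ n → 0 < Benford.prodSeq X n ω :=
    fun ω hω n _ => Finset.prod_pos fun k hk => hω k (Finset.mem_Icc.1 hk).1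
  constructor
  · intro hB h h0
    refine Benford.tendsto_integral_weyl hmeas b h ?_
    filter_upwards [hB, hpos'] with ω hω hωpos
    exact (Benford.isBenford_iff_tendsto_weyl hb (hprod ω hωpos)).1 hω h h0
  · intro hW
    -- Only countably many h occur, so a single null set serves them all.
    have hall : ∀ᵐ ω ∂P, ∀ h : ℤ, 0 < h → Tendsto (fun L : ℕ => (1 / (L : ℂ)) *
        ∑ l ∈ Finset.Icc 1 L, Benford.e h (Real.logb b (Benford.prodSeq X l ω)))
        atTop (𝓝 0) := ae_all_iff.2 fun h => by
      by_cases h0 : 0 < h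
      · filter_upwards [hstat.ae_tendsto_weyl hmeas hpos' b h (hW h h0)] with ω hω _ using hω
      · exact Eventually.of_forall fun ω h' => absurd h' h0
    filter_upwards [hall, hpos'] with ω hω hωpos
    exact (Benford.isBenford_iff_tendsto_weyl hb (hprod ω hωpos)).2 hω
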